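/- Let $d\ge 2$ and $n\ge 2$ be integers and $\omega=e^{2\pi i/d}$. For an integer $m\ge 1$ let $$|G_n^{m}\rangle = Z_e^{m}\,|+\rangle^{\otimes n}=\frac{1}{\sqrt{d^n}}\sum_{q_1,\dots,q_n=0}^{d-1}\omega^{m\,q_1\cdots q_n}\,|q_1\dots q_n\rangle\in(\mathbb C^d)^{\otimes n}$$ be the $n$-qudit elementary hypergraph state of multiplicity $m$, where $|+\rangle=d^{-1/2}\sum_{q=0}^{d-1}|q\rangle$ and $Z_e|q_1\dots q_n\rangle=\omega^{q_1\cdots q_n}|q_1\dots q_n\rangle$. For $|\psi\rangle\in(\mathbb C^d)^{\otimes n}$ let $$E(|\psi\rangle)=\min_{AB}\Bigl(1-\max_{|\phi^A\rangle,|\phi^B\rangle}\bigl|(\langle\phi^A|\langle\phi^B|)|\psi\rangle\bigr|^2\Bigr)$$ be its multipartite entanglement, where $AB$ runs over the bipartitions of $\{1,\dots,n\}$ into two non-empty sets and $|\phi^A\rangle$, $|\phi^B\rangle$ over the unit vectors of the corresponding tensor factors. Let $\operatorname{lpf}(k)$ denote the least prime factor of an integer $k\ge 2$. Then for every positive divisor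 $m^*$ of $d$ with $m^*<d$, the number $d/\operatorname{lpf}(d/m^*)$ is of the form $\beta m^*$ with an integer $1\le\beta<d/m^*$, and $$\min_{1\le\beta<d/m^*}E(|G_n^{\beta m^*}\rangle)=E(|G_n^{d/\operatorname{lpf}(d/m^*)}\rangle).$$ Moreover, for every integer $m_e$ with $1\le m_e<d$, $$E(|G_n^{d/\operatorname{lpf}(d)}\rangle)\le E(|G_n^{m_e}\rangle)\le E(|G_n^{1}\rangle).$$ -/

import Mathlib

namespace QuditHypergraph

noncomputable section

/-- The Hilbert space `⨂_{i ∈ V} ℂ^d` of qudits labelled by `V`, in the computational basis: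
a vector is the family of its amplitudes on the basis states `|q⟩`, `q : V → {0, …, d-1}`,
with the Hilbert (`ℓ²`) inner product. -/
abbrev QuditSpace (d : ℕ) (V : Type) [Fintype V] [DecidableEq V] : Type :=
  EuclideanSpace ℂ (V → Fin d)

/-- The primitive root of unity `ω = e^{2πi/d}`. -/
def omega (d : ℕ) : ℂ := Complex.exp (2 * Real.pi * Complex.I / d)

/-- The one-qudit state `|+⟩ = d^{-1/2} ∑_q |q⟩`. -/
def plus (d : ℕ) : EuclideanSpace ℂ (Fin d) :=
  WithLp.toLp 2 fun _ => ((Real.sqrt d : ℝ) : ℂ)⁻¹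

/-- The product state `|+⟩^V = ⨂_{i ∈ V} |+⟩_i`. -/
def plusState (d : ℕ) (V : Type) [Fintype V] [DecidableEq V] : QuditSpace d V :=
  WithLp.toLp 2 fun q => ∏ i, plus d (q i)

/-- The controlled phase gate `Z_e = ∑_q ω^{∏_{i ∈ e} q_i} |q⟩⟨q|` of a hyperedge `e ⊆ V`. -/
def controlledZ (d : ℕ) {V : Type} [Fintype V] [DecidableEq V] (e : Finset V) :
    QuditSpace d V →ₗ[ℂ] QuditSpace d V where
  toFun ψ := WithLp.toLp 2 fun q => omega d ^ (∏ i ∈ e, (q i : ℕ)) * ψ q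
  map_add' ψ χ := by
    ext q
    simp [mul_add]
  map_smul' c ψ := by
    ext q
    simp [mul_left_comm]

/-- The elementary hypergraph state `|G_n^m⟩ = Z_e^m |+⟩^V`, with `V = {1, …, n}` and the single
hyperedge `e = V` of multiplicity `m`. -/
def elementaryState (d n m : ℕ) : QuditSpace d (Fin n) :=
  (controlledZ d (Finset.univ : Finset (Fin n)) ^ m) (plusState d (Fin n))

/-- The product vector `|φ^A⟩|φ^B⟩` with respect to the bipartition of `V` into `A` and its
complement `B`. -/
def productState {d : ℕ} {V : Type} [Fintype V] [DecidableEq V] (A : Finset V)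
    (φA : QuditSpace d {i // i ∈ A}) (φB : QuditSpace d {i // i ∉ A}) : QuditSpace d V :=
  WithLp.toLp 2 fun q => φA (fun i => q i) * φB (fun i => q i)

/-- `α^{AB}(ψ)`: the largest squared overlap `|⟨φ^A φ^B | ψ⟩|²` of `ψ` with a pure (unit) state
that is separable with respect to the bipartition of `V` into `A` and its complement `B`. -/
def maxOverlap {d : ℕ} {V : Type} [Fintype V] [DecidableEq V] (A : Finset V)
    (ψ : QuditSpace d V) : ℝ :=
  sSup {x : ℝ | ∃ (φA : QuditSpace d {i // i ∈ A}) (φB : QuditSpace d {i // i ∉ A}),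
    ‖φA‖ = 1 ∧ ‖φB‖ = 1 ∧ x = ‖inner ℂ (productState A φA φB) ψ‖ ^ 2}

/-- The bipartite entanglement `E^{AB}(ψ) = 1 - α^{AB}(ψ)`. -/
def bipartiteEntanglement {d : ℕ} {V : Type} [Fintype V] [DecidableEq V] (A : Finset V)
    (ψ : QuditSpace d V) : ℝ :=
  1 - maxOverlap A ψ

/-- The multipartite entanglement `E(ψ)`: the minimum of `E^{AB}(ψ)` over all the bipartitions
of `V` into two non-empty parts `A` and `B`. -/
def entanglement {d : ℕ} {V : Type} [Fintype V] [DecidableEq V] (ψ : QuditSpace d V) : ℝ :=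
  ⨅ A : {A : Finset V // A.Nonempty ∧ Aᶜ.Nonempty}, bipartiteEntanglement A.1 ψ

end

end QuditHypergraph

/-!
Cut the qudits into `A` and `B`. Up to a scalar, the Schmidt matrix of `|G_n^m⟩` is the kernel
`K(x, y) = ω^{m ∏ x ∏ y}`. Its column sums and the entries of its Gram matrix are again sums of the
form `∑_z ω^{k ∏ z}`, and these are nonnegative: summing over one coordinate gives `d` or `0`.
Hence the Schur test bounds the largest squared Schmidt coefficient by `⟨+^n|G_n^m⟩`, whatever the
cut. When `A` is a single qudit, projecting that qudit onto `|+⟩` attains the bound. Therefore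
`E(G_n^m) = 1 - ⟨+^n|G_n^m⟩`, and the overlap is the proportion of tuples `z` of length `n - 1` with
`m z_1 ⋯ z_{n-1} ≡ 0` modulo `d`.

This proportion grows with `gcd(d, m)` in the order of divisibility, so the extreme multiplicities
are `1` and those of the form `d / p` with `p` prime. For the latter the tuples counted are those
with some entry divisible by `p`, whose number `d^{n-1} - (d - d/p)^{n-1}` is largest for the least
admissible `p`.
-/

namespace QuditHypergraph

open Finset ComplexConjugate
open scoped ComplexOrder

lemma sum_sum_mul_mul_le_of_sum_le {X : Type*} [Fintype X] {w : X → X → ℝ} {C : ℝ}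
    (hw : ∀ x x', 0 ≤ w x x') (hsymm : ∀ x x', w x x' = w x' x) (hrow : ∀ x, ∑ x', w x x' ≤ C)
    (h : X → ℝ) :
    ∑ x, ∑ x', w x x' * (h x * h x') ≤ C * ∑ x, h x ^ 2 := by
  have amgm : ∑ x, ∑ x', w x x' * (h x * h x') ≤
      (∑ x, ∑ x', w x x' * h x ^ 2 + ∑ x, ∑ x', w x x' * h x' ^ 2) / 2 := by
    simp only [← sum_add_distrib, sum_div]
    refine sum_le_sum fun x _ => sum_le_sum fun x' _ => ?_
    nlinarith [mul_le_mul_of_nonneg_left (two_mul_le_add_sq (h x) (h x')) (hw x x')]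
  have swap : ∑ x, ∑ x', w x x' * h x' ^ 2 = ∑ x, ∑ x', w x x' * h x ^ 2 := by
    rw [sum_comm]
    exact sum_congr rfl fun x _ => sum_congr rfl fun x' _ => by rw [hsymm]
  calc ∑ x, ∑ x', w x x' * (h x * h x') ≤ ∑ x, (∑ x', w x x') * h x ^ 2 := by
        simp only [sum_mul]
        linarith
    _ ≤ ∑ x, C * h x ^ 2 := by gcongr with x; exact hrow x
    _ = C * ∑ x, h x ^ 2 := (mul_sum ..).symm

lemma sum_norm_eq_norm_sum_of_nonneg {𝕜 ι : Type*} [RCLike 𝕜] {s : Finset ι} {z : ι → 𝕜}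
    (hz : ∀ i ∈ s, 0 ≤ z i) : ∑ i ∈ s, ‖z i‖ = ‖∑ i ∈ s, z i‖ := by
  apply RCLike.ofReal_injective (K := 𝕜)
  rw [RCLike.norm_of_nonneg' (sum_nonneg hz)]
  push_cast
  exact sum_congr rfl fun i hi => RCLike.norm_of_nonneg' (hz i hi)

lemma sum_norm_sq_sum_mul_le {𝕜 X Y : Type*} [RCLike 𝕜] [Fintype X] [Fintype Y] {K : X → Y → 𝕜}
    (hK : ∀ x y, ‖K x y‖ ≤ 1) (hcol : ∀ y, 0 ≤ ∑ x, K x y)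
    (hgram : ∀ x x', 0 ≤ ∑ y, K x y * conj (K x' y)) (f : X → 𝕜) :
    ∑ y, ‖∑ x, K x y * f x‖ ^ 2 ≤ ‖∑ y, ∑ x, K x y‖ * ∑ x, ‖f x‖ ^ 2 := by
  set gram : X → X → 𝕜 := fun x x' => ∑ y, K x y * conj (K x' y) with gram_def
  have expand : ((∑ y, ‖∑ x, K x y * f x‖ ^ 2 : ℝ) : 𝕜) =
      ∑ x, ∑ x', gram x x' * (f x * conj (f x')) := by
    push_cast
    simp only [← RCLike.mul_conj, map_sum, map_mul, sum_mul_sum, gram_def, sum_mul _ _ (_ * _)]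
    rw [sum_comm]
    refine sum_congr rfl fun x _ => ?_
    rw [sum_comm]
    exact sum_congr rfl fun x' _ => sum_congr rfl fun y _ => mul_mul_mul_comm ..
  have gram_symm (x x') : ‖gram x x'‖ = ‖gram x' x‖ := by
    rw [← RCLike.norm_conj]
    simp only [gram_def, map_sum, map_mul, RCLike.conj_conj, mul_comm]
  have gram_row (x) : ∑ x', ‖gram x x'‖ ≤ ‖∑ y, ∑ x, K x y‖ :=
    calc ∑ x', ‖gram x x'‖ = ‖∑ x', gram x x'‖ :=
          sum_norm_eq_norm_sum_of_nonneg fun x' _ => hgram x x'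
      _ = ‖∑ y, K x y * conj (∑ x', K x' y)‖ := by
          simp only [gram_def, map_sum, mul_sum]
          rw [sum_comm]
      _ ≤ ∑ y, ‖∑ x', K x' y‖ := by
          refine norm_sum_le_of_le _ fun y _ => ?_
          rw [norm_mul, RCLike.norm_conj]
          exact mul_le_of_le_one_left (norm_nonneg _) (hK x y)
      _ = ‖∑ y, ∑ x', K x' y‖ := sum_norm_eq_norm_sum_of_nonneg fun y _ => hcol y
  calc ∑ y, ‖∑ x, K x y * f x‖ ^ 2
      = ‖∑ x, ∑ x', gram x x' * (f x * conj (f x'))‖ := by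
        rw [← expand, RCLike.norm_of_nonneg (by positivity)]
    _ ≤ ∑ x, ∑ x', ‖gram x x'‖ * (‖f x‖ * ‖f x'‖) := by
        refine norm_sum_le_of_le _ fun x _ => norm_sum_le_of_le _ fun x' _ => ?_
        rw [norm_mul, norm_mul, RCLike.norm_conj]
    _ ≤ ‖∑ y, ∑ x, K x y‖ * ∑ x, ‖f x‖ ^ 2 :=
        sum_sum_mul_mul_le_of_sum_le (fun _ _ => norm_nonneg _) gram_symm gram_row _

/-- The exponential sum `∑_z ω^{m z_1 ⋯ z_k}` over the tuples `z` indexed by `ι`, where `k = |ι|`.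
It equals `d^k ⟨+^k|G_k^m⟩`. -/
noncomputable def phaseSum (d m : ℕ) (ι : Type*) [Fintype ι] [DecidableEq ι] : ℂ :=
  ∑ z : ι → Fin d, omega d ^ (m * ∏ i, (z i : ℕ))

/-- The number of tuples `z` indexed by `ι`, with entries in `{0, …, d-1}`, for which
`m ∏ z_i ≡ 0` modulo `d`. -/
def zeroCount (d m : ℕ) (ι : Type*) [Fintype ι] [DecidableEq ι] : ℕ :=
  #{z : ι → Fin d | d ∣ m * ∏ i, (z i : ℕ)}

lemma isPrimitiveRoot_omega (d : ℕ) [NeZero d] : IsPrimitiveRoot (omega d) d :=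
  Complex.isPrimitiveRoot_exp d (NeZero.ne d)

lemma norm_omega (d : ℕ) [NeZero d] : ‖omega d‖ = 1 :=
  (isPrimitiveRoot_omega d).norm'_eq_one (NeZero.ne d)

lemma conj_omega (d : ℕ) [NeZero d] : conj (omega d) = omega d ^ (d - 1) := by
  have hω : omega d * omega d ^ (d - 1) = 1 := by
    rw [mul_pow_sub_one (NeZero.ne d), (isPrimitiveRoot_omega d).pow_eq_one]
  rw [← Complex.inv_eq_conj (norm_omega d), inv_eq_of_mul_eq_one_right hω]

/-- The configurations on `V` as pairs of a configuration on `A` and one outside `A`. -/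
def glueEquiv {V : Type*} [DecidableEq V] (A : Finset V) (κ : Type*) :
    ({i // i ∈ A} → κ) × ({i // i ∉ A} → κ) ≃ (V → κ) :=
  (Equiv.piEquivPiSubtypeProd (· ∈ A) fun _ => κ).symm

lemma prod_comp_glueEquiv {V κ M : Type*} [Fintype V] [DecidableEq V] [CommMonoid M] (A : Finset V)
    (x : {i // i ∈ A} → κ) (y : {i // i ∉ A} → κ) (g : κ → M) :
    ∏ i, g (glueEquiv A κ (x, y) i) = (∏ i, g (x i)) * ∏ i, g (y i) := by
  rw [← Fintype.prod_subtype_mul_prod_subtype (· ∈ A)]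
  congr! 3 with i _ i _ <;> simp [glueEquiv, i.2]

section PhaseSum

variable {d : ℕ} {ι : Type*} [Fintype ι] [DecidableEq ι]

lemma phaseSum_eq_sum_phaseSum (m : ℕ) (A : Finset ι) :
    phaseSum d m ι =
      ∑ y : {i // i ∉ A} → Fin d, phaseSum d (m * ∏ i, (y i : ℕ)) {i // i ∈ A} := by
  simp only [phaseSum]
  rw [← (glueEquiv A (Fin d)).sum_comp, Fintype.sum_prod_type_right]
  refine sum_congr rfl fun y _ => sum_congr rfl fun x _ => ?_
  rw [prod_comp_glueEquiv A x y fun t : Fin d => (t : ℕ), mul_assoc,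
    mul_comm (∏ i, (x i : ℕ))]

lemma phaseSum_of_unique [NeZero d] [Unique ι] (m : ℕ) :
    phaseSum d m ι = if d ∣ m then (d : ℂ) else 0 := by
  have hω := isPrimitiveRoot_omega d
  have hgeom : phaseSum d m ι = ∑ t ∈ range d, (omega d ^ m) ^ t := by
    rw [phaseSum, ← (Equiv.funUnique ι (Fin d)).symm.sum_comp,
      ← Fin.sum_univ_eq_sum_range fun t => (omega d ^ m) ^ t]
    simp [pow_mul]
  rw [hgeom]
  split_ifs with hm
  · simp [(hω.pow_eq_one_iff_dvd m).2 hm]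
  · have hne : omega d ^ m - 1 ≠ 0 := sub_ne_zero.2 (mt (hω.pow_eq_one_iff_dvd m).1 hm)
    refine (mul_eq_zero.1 ?_).resolve_right hne
    rw [geom_sum_mul, ← pow_mul, mul_comm, pow_mul, hω.pow_eq_one, one_pow, sub_self]

lemma phaseSum_eq_mul_zeroCount [NeZero d] (m : ℕ) (i₀ : ι) :
    phaseSum d m ι = d * zeroCount d m {i // i ∉ ({i₀} : Finset ι)} := by
  rw [phaseSum_eq_sum_phaseSum m {i₀}]
  simp only [phaseSum_of_unique, sum_ite, sum_const_zero, add_zero, sum_const, nsmul_eq_mul,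
    zeroCount, mul_comm]

lemma phaseSum_nonneg [NeZero d] [Nonempty ι] (m : ℕ) : 0 ≤ phaseSum d m ι := by
  rw [phaseSum_eq_mul_zeroCount m (Classical.arbitrary ι)]
  positivity

lemma sum_norm_sq_sum_omega_mul_le [NeZero d] {κ : Type*} [Fintype κ] [DecidableEq κ] [Nonempty ι]
    [Nonempty κ] (m : ℕ) (f : (ι → Fin d) → ℂ) :
    ∑ y : κ → Fin d, ‖∑ x, omega d ^ (m * (∏ j, (y j : ℕ)) * ∏ i, (x i : ℕ)) * f x‖ ^ 2 ≤
      ‖∑ y : κ → Fin d, phaseSum d (m * ∏ j, (y j : ℕ)) ι‖ * ∑ x, ‖f x‖ ^ 2 := by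
  have hnorm (x : ι → Fin d) (y : κ → Fin d) :
      ‖omega d ^ (m * (∏ j, (y j : ℕ)) * ∏ i, (x i : ℕ))‖ ≤ 1 := by simp [norm_omega]
  have gram (x x' : ι → Fin d) :
      ∑ y : κ → Fin d, omega d ^ (m * (∏ j, (y j : ℕ)) * ∏ i, (x i : ℕ)) *
        conj (omega d ^ (m * (∏ j, (y j : ℕ)) * ∏ i, (x' i : ℕ))) =
          phaseSum d (m * (∏ i, (x i : ℕ) + (d - 1) * ∏ i, (x' i : ℕ))) κ := by
    refine sum_congr rfl fun y _ => ?_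
    rw [map_pow, conj_omega, ← pow_mul, ← pow_add]
    ring_nf
  exact sum_norm_sq_sum_mul_le hnorm (fun y => phaseSum_nonneg (m * ∏ j, (y j : ℕ)))
    (fun x x' => (phaseSum_nonneg _).trans_eq (gram x x').symm) f

end PhaseSum

section PartialInner

variable {d : ℕ} {V : Type} [Fintype V] [DecidableEq V] (A : Finset V)

/-- The partial inner product `⟨φ^A|ψ⟩`, a vector of the tensor factor of the qudits outside `A`.
-/
noncomputable def partialInner (φA : QuditSpace d {i // i ∈ A}) (ψ : QuditSpace d V) :
    QuditSpace d {i // i ∉ A} :=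
  WithLp.toLp 2 fun y =>
    ∑ x, conj (φA x) * ψ (glueEquiv A (Fin d) (x, y))

lemma productState_glueEquiv (φA : QuditSpace d {i // i ∈ A})
    (φB : QuditSpace d {i // i ∉ A}) (x : {i // i ∈ A} → Fin d) (y : {i // i ∉ A} → Fin d) :
    productState A φA φB (glueEquiv A (Fin d) (x, y)) =
      φA x * φB y := by
  have hxy := (glueEquiv A (Fin d)).symm_apply_apply (x, y)
  exact congrArg₂ (φA · * φB ·) (congrArg Prod.fst hxy) (congrArg Prod.snd hxy)

lemma inner_productState (φA : QuditSpace d {i // i ∈ A}) (φB : QuditSpace d {i // i ∉ A})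
    (ψ : QuditSpace d V) :
    inner ℂ (productState A φA φB) ψ = inner ℂ φB (partialInner A φA ψ) := by
  rw [PiLp.inner_apply, ← (glueEquiv A (Fin d)).sum_comp,
    Fintype.sum_prod_type_right, PiLp.inner_apply]
  refine sum_congr rfl fun y _ => ?_
  simp only [productState_glueEquiv, RCLike.inner_apply, partialInner,
    map_mul, sum_mul]
  exact sum_congr rfl fun x _ => by ring

lemma norm_productState (φA : QuditSpace d {i // i ∈ A}) (φB : QuditSpace d {i // i ∉ A}) :
    ‖productState A φA φB‖ = ‖φA‖ * ‖φB‖ := by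
  rw [← sq_eq_sq₀ (norm_nonneg _) (by positivity), mul_pow, EuclideanSpace.norm_sq_eq,
    EuclideanSpace.norm_sq_eq φA, EuclideanSpace.norm_sq_eq φB, sum_mul_sum,
    ← (glueEquiv A (Fin d)).sum_comp, Fintype.sum_prod_type]
  simp only [productState_glueEquiv, norm_mul, mul_pow]

variable {A}

lemma maxOverlap_le {ψ : QuditSpace d V} {C : ℝ} (hC : 0 ≤ C)
    (h : ∀ φA : QuditSpace d {i // i ∈ A}, ‖φA‖ = 1 → ‖partialInner A φA ψ‖ ^ 2 ≤ C) :
    maxOverlap A ψ ≤ C := by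
  refine Real.sSup_le ?_ hC
  rintro _ ⟨φA, φB, hφA, hφB, rfl⟩
  calc ‖inner ℂ (productState A φA φB) ψ‖ ^ 2
      ≤ (‖φB‖ * ‖partialInner A φA ψ‖) ^ 2 := by
        rw [inner_productState]
        gcongr
        exact norm_inner_le_norm _ _
    _ ≤ C := by simpa only [hφB, one_mul] using h φA hφA

lemma norm_inner_sq_le_maxOverlap (ψ : QuditSpace d V) {φA : QuditSpace d {i // i ∈ A}}
    {φB : QuditSpace d {i // i ∉ A}} (hφA : ‖φA‖ = 1) (hφB : ‖φB‖ = 1) :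
    ‖inner ℂ (productState A φA φB) ψ‖ ^ 2 ≤ maxOverlap A ψ := by
  refine le_csSup ⟨‖ψ‖ ^ 2, ?_⟩ ⟨φA, φB, hφA, hφB, rfl⟩
  rintro _ ⟨φA, φB, hφA, hφB, rfl⟩
  gcongr
  simpa only [norm_productState, hφA, hφB, one_mul] using
    norm_inner_le_norm (𝕜 := ℂ) (productState A φA φB) ψ

lemma norm_sq_partialInner_le_maxOverlap (ψ : QuditSpace d V) {φA : QuditSpace d {i // i ∈ A}}
    (hφA : ‖φA‖ = 1) : ‖partialInner A φA ψ‖ ^ 2 ≤ maxOverlap A ψ := by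
  set v := partialInner A φA ψ
  rcases eq_or_ne v 0 with hv | hv
  · rw [hv, norm_zero, zero_pow two_ne_zero]
    refine Real.sSup_nonneg ?_
    rintro _ ⟨_, _, _, _, rfl⟩
    positivity
  · calc ‖v‖ ^ 2 = ‖inner ℂ (productState A φA ((‖v‖ : ℂ)⁻¹ • v)) ψ‖ ^ 2 := by
          rw [inner_productState, inner_smul_left, inner_self_eq_norm_sq_to_K]
          simp [pow_two, v, norm_ne_zero_iff.2 hv]
      _ ≤ maxOverlap A ψ := norm_inner_sq_le_maxOverlap ψ hφA (norm_smul_inv_norm hv)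

end PartialInner

section ElementaryState

variable {d n : ℕ}

lemma elementaryState_apply (d n m : ℕ) (q : Fin n → Fin d) :
    elementaryState d n m q = omega d ^ (m * ∏ i, (q i : ℕ)) * ((√d : ℂ)⁻¹) ^ n := by
  induction m with
  | zero => simp [elementaryState, plusState, plus]
  | succ m ih =>
    have hsucc : elementaryState d n (m + 1) q =
        omega d ^ (∏ i, (q i : ℕ)) * elementaryState d n m q := by
      simp [elementaryState, pow_succ', controlledZ]
    rw [hsucc, ih]
    ring

lemma norm_sq_partialInner_elementaryState (m : ℕ) (A : Finset (Fin n))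
    (φA : QuditSpace d {i // i ∈ A}) :
    ‖partialInner A φA (elementaryState d n m)‖ ^ 2 =
      (∑ y : {i // i ∉ A} → Fin d,
        ‖∑ x, omega d ^ (m * (∏ j, (y j : ℕ)) * ∏ i, (x i : ℕ)) * conj (φA x)‖ ^ 2) / d ^ n := by
  rw [EuclideanSpace.norm_sq_eq, sum_div]
  refine sum_congr rfl fun y _ => ?_
  have amplitude : partialInner A φA (elementaryState d n m) y =
      (∑ x, omega d ^ (m * (∏ j, (y j : ℕ)) * ∏ i, (x i : ℕ)) * conj (φA x)) * (√d : ℂ)⁻¹ ^ n := by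
    simp only [partialInner, elementaryState_apply, sum_mul]
    refine sum_congr rfl fun x _ => ?_
    rw [prod_comp_glueEquiv A x y fun t : Fin d => (t : ℕ),
      mul_comm (∏ i, (x i : ℕ)), ← mul_assoc m]
    ring
  have hsqrt : ‖(√d : ℂ)⁻¹ ^ n‖ ^ 2 = ((d : ℝ) ^ n)⁻¹ := by
    rw [norm_pow, norm_inv, Complex.norm_real, Real.norm_of_nonneg (Real.sqrt_nonneg _),
      pow_right_comm, inv_pow, Real.sq_sqrt (Nat.cast_nonneg d), inv_pow]
  rw [amplitude, norm_mul, mul_pow, hsqrt, div_eq_mul_inv]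

lemma maxOverlap_elementaryState_le [NeZero d] (m : ℕ) {A : Finset (Fin n)} (hA : A.Nonempty)
    (hA' : Aᶜ.Nonempty) :
    maxOverlap A (elementaryState d n m) ≤ ‖phaseSum d m (Fin n)‖ / d ^ n := by
  have : Nonempty {i // i ∈ A} := hA.to_subtype
  have : Nonempty {i // i ∉ A} := by simpa [Finset.Nonempty] using hA'
  refine maxOverlap_le (by positivity) fun φA hφA => ?_
  rw [norm_sq_partialInner_elementaryState, phaseSum_eq_sum_phaseSum m A]
  gcongr
  refine (sum_norm_sq_sum_omega_mul_le m fun x => conj (φA x)).trans_eq ?_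
  simp only [RCLike.norm_conj, ← EuclideanSpace.norm_sq_eq, hφA, one_pow, mul_one]

lemma norm_plusState (d : ℕ) [NeZero d] (V : Type) [Fintype V] [DecidableEq V] :
    ‖plusState d V‖ = 1 := by
  rw [← sq_eq_sq₀ (norm_nonneg _) zero_le_one, EuclideanSpace.norm_sq_eq]
  simp [plusState, plus, pow_right_comm _ _ 2]

lemma le_maxOverlap_singleton_elementaryState [NeZero d] (m : ℕ) (i₀ : Fin n) :
    ‖phaseSum d m (Fin n)‖ / d ^ n ≤ maxOverlap {i₀} (elementaryState d n m) := by
  refine le_trans ?_ (norm_sq_partialInner_le_maxOverlap _ (norm_plusState d _))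
  rw [norm_sq_partialInner_elementaryState, phaseSum_eq_sum_phaseSum m {i₀}]
  gcongr
  refine norm_sum_le_of_le _ fun y _ => ?_
  have amplitude : ∑ x, omega d ^ (m * (∏ j, (y j : ℕ)) * ∏ i, (x i : ℕ)) *
      conj (plusState d {i // i ∈ ({i₀} : Finset (Fin n))} x) =
        phaseSum d (m * ∏ j, (y j : ℕ)) {i // i ∈ ({i₀} : Finset (Fin n))} * (√d : ℂ)⁻¹ := by
    simp [plusState, plus, phaseSum, sum_mul]
  rw [amplitude, phaseSum_of_unique]
  split_ifs
  · have hsq : |√(d : ℝ)| ^ 2 = d := by rw [sq_abs, Real.sq_sqrt d.cast_nonneg]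
    simp [mul_pow, hsq, pow_two (d : ℝ)]
  · simp

lemma entanglement_elementaryState [NeZero d] (m : ℕ) (hn : 2 ≤ n) :
    entanglement (elementaryState d n m) = 1 - ‖phaseSum d m (Fin n)‖ / d ^ n := by
  have : Nontrivial (Fin n) := Fin.nontrivial_iff_two_le.2 hn
  obtain ⟨i₀, j₀, hij⟩ := exists_pair_ne (Fin n)
  have hA₀ : ({i₀} : Finset (Fin n)).Nonempty ∧ ({i₀} : Finset (Fin n))ᶜ.Nonempty :=
    ⟨singleton_nonempty _, j₀, by simpa using hij.symm⟩
  have : Nonempty {A : Finset (Fin n) // A.Nonempty ∧ Aᶜ.Nonempty} := ⟨⟨_, hA₀⟩⟩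
  apply le_antisymm
  · refine (ciInf_le (Set.finite_range _).bddBelow ⟨{i₀}, hA₀⟩).trans ?_
    rw [bipartiteEntanglement]
    gcongr
    exact le_maxOverlap_singleton_elementaryState m i₀
  · refine le_ciInf fun A => ?_
    rw [bipartiteEntanglement]
    gcongr
    exact maxOverlap_elementaryState_le m A.2.1 A.2.2

lemma entanglement_elementaryState_le_of_zeroCount_le [NeZero d] {m m' : ℕ} (hn : 2 ≤ n)
    (h : ∀ A : Finset (Fin n), zeroCount d m' {i // i ∉ A} ≤ zeroCount d m {i // i ∉ A}) :
    entanglement (elementaryState d n m) ≤ entanglement (elementaryState d n m') := by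
  let i₀ : Fin n := ⟨0, by lia⟩
  rw [entanglement_elementaryState m hn, entanglement_elementaryState m' hn,
    phaseSum_eq_mul_zeroCount m i₀, phaseSum_eq_mul_zeroCount m' i₀]
  simp only [norm_mul, Complex.norm_natCast]
  gcongr
  exact h {i₀}

end ElementaryState

lemma zeroCount_le_of_gcd_dvd {d m m' : ℕ} (h : d.gcd m ∣ m') (ι : Type*) [Fintype ι]
    [DecidableEq ι] : zeroCount d m ι ≤ zeroCount d m' ι := by
  refine card_le_card (monotone_filter_right _ fun z _ hz => ?_)
  exact (Nat.dvd_gcd_mul_iff_dvd_mul.2 hz).trans (mul_dvd_mul_right h _)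

lemma card_filter_fin_dvd {d q : ℕ} (hq : q ∣ d) : #{t : Fin d | q ∣ (t : ℕ)} = d / q := by
  rcases Nat.eq_zero_or_pos q with rfl | hq0
  · obtain rfl := Nat.eq_zero_of_zero_dvd hq
    rfl
  calc #{t : Fin d | q ∣ (t : ℕ)} = #{t ∈ range d | q ∣ t} := by
        simp only [card_filter]
        exact Fin.sum_univ_eq_sum_range (fun t => if q ∣ t then 1 else 0) d
    _ = d.count (· ≡ 0 [MOD q]) := by
        simp only [Nat.count_eq_card_filter_range, Nat.modEq_zero_iff_dvd]
    _ = d / q := by simp [Nat.count_modEq_card d hq0, Nat.mod_eq_zero_of_dvd hq]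

lemma card_filter_fin_not_dvd_prod {d q : ℕ} (hq : q.Prime) (hqd : q ∣ d) (ι : Type*)
    [Fintype ι] [DecidableEq ι] :
    #{z : ι → Fin d | ¬ q ∣ ∏ i, (z i : ℕ)} = (d - d / q) ^ Fintype.card ι := by
  have hcompl : #{t : Fin d | ¬ q ∣ (t : ℕ)} = d - d / q := by
    rw [filter_not, card_sdiff_of_subset (filter_subset _ _), card_filter_fin_dvd hqd, card_univ,
      Fintype.card_fin]
  rw [← hcompl, ← card_univ, ← prod_const, ← Fintype.card_piFinset]
  congr 1 with z
  simp [hq.prime.dvd_finsetProd_iff]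

lemma zeroCount_div_prime {d q : ℕ} [NeZero d] (hq : q.Prime) (hqd : q ∣ d) (ι : Type*)
    [Fintype ι] [DecidableEq ι] :
    zeroCount d (d / q) ι = d ^ Fintype.card ι - (d - d / q) ^ Fintype.card ι := by
  have hdvd (k : ℕ) : d ∣ d / q * k ↔ q ∣ k := by
    have hpos : 0 < d / q := Nat.div_pos (Nat.le_of_dvd (NeZero.pos d) hqd) hq.pos
    rw [← Nat.mul_dvd_mul_iff_left (b := q) hpos, Nat.div_mul_cancel hqd]
  have hcompl := card_filter_add_card_filter_not (s := (univ : Finset (ι → Fin d)))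
    fun z => q ∣ ∏ i, (z i : ℕ)
  rw [card_filter_fin_not_dvd_prod hq hqd, card_univ, Fintype.card_fun, Fintype.card_fin] at hcompl
  simp only [zeroCount, hdvd]
  lia

lemma zeroCount_div_le_of_le {d p q : ℕ} [NeZero d] (hp : p.Prime) (hpd : p ∣ d) (hq : q.Prime)
    (hqd : q ∣ d) (hpq : p ≤ q) (ι : Type*) [Fintype ι] [DecidableEq ι] :
    zeroCount d (d / q) ι ≤ zeroCount d (d / p) ι := by
  rw [zeroCount_div_prime hp hpd, zeroCount_div_prime hq hqd]
  have := Nat.div_le_div_left (a := d) hpq hp.pos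
  gcongr

lemma zeroCount_le_zeroCount_div_minFac {d m k : ℕ} [NeZero d] (hmd : m ∣ d) (hmk : m ∣ k)
    (hdk : ¬ d ∣ k) (ι : Type*) [Fintype ι] [DecidableEq ι] :
    zeroCount d k ι ≤ zeroCount d (d / (d / m).minFac) ι := by
  have hgd : d.gcd k ∣ d := Nat.gcd_dvd_left d k
  have hquot : d / d.gcd k ∣ d / m := Nat.div_dvd_div_left hgd (Nat.dvd_gcd hmd hmk)
  have hquot_ne : d / d.gcd k ≠ 1 := by
    rwa [ne_eq, Nat.div_eq_iff_eq_mul_left (Nat.gcd_pos_of_pos_left k (NeZero.pos d)) hgd,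
      one_mul, eq_comm, Nat.gcd_eq_left_iff_dvd]
  obtain ⟨q, hq, hq_quot⟩ := Nat.exists_prime_and_dvd hquot_ne
  have hqd : q ∣ d := hq_quot.trans (Nat.div_dvd_of_dvd hgd)
  have hqm : q ∣ d / m := hq_quot.trans hquot
  have hp : (d / m).minFac.Prime := Nat.minFac_prime fun h => hq.not_dvd_one (h ▸ hqm)
  have hg_quot : d.gcd k ∣ d / q := by
    rwa [Nat.dvd_div_iff_mul_dvd hqd, mul_comm, ← Nat.dvd_div_iff_mul_dvd hgd]
  calc zeroCount d k ι ≤ zeroCount d (d / q) ι := zeroCount_le_of_gcd_dvd hg_quot ι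
    _ ≤ zeroCount d (d / (d / m).minFac) ι :=
        zeroCount_div_le_of_le hp ((Nat.minFac_dvd _).trans (Nat.div_dvd_of_dvd hmd)) hq hqd
          (Nat.minFac_le_of_dvd hq.two_le hqm) ι

lemma exists_mul_eq_div_minFac {d m : ℕ} (hmd : m ∣ d) (hm : m < d) :
    ∃ β ∈ Set.Ico 1 (d / m), β * m = d / (d / m).minFac := by
  obtain ⟨k, rfl⟩ := hmd
  have hm0 : 0 < m := Nat.pos_of_lt_mul_right hm
  have hk : 1 < k := (Nat.lt_mul_iff_one_lt_right hm0).1 hm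
  rw [Nat.mul_div_cancel_left _ hm0]
  refine ⟨k / k.minFac, ⟨Nat.div_pos (Nat.minFac_le hk.pos) k.minFac_pos,
    Nat.div_lt_self hk.pos (Nat.minFac_prime hk.ne').one_lt⟩, ?_⟩
  rw [Nat.mul_div_assoc _ (Nat.minFac_dvd k), mul_comm]

lemma entanglement_div_minFac_le {d n m k : ℕ} [NeZero d] (hn : 2 ≤ n) (hmd : m ∣ d) (hmk : m ∣ k)
    (hdk : ¬ d ∣ k) :
    entanglement (elementaryState d n (d / (d / m).minFac)) ≤
      entanglement (elementaryState d n k) :=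
  entanglement_elementaryState_le_of_zeroCount_le hn fun _ =>
    zeroCount_le_zeroCount_div_minFac hmd hmk hdk _

lemma entanglement_le_entanglement_one {d n : ℕ} [NeZero d] (hn : 2 ≤ n) (m : ℕ) :
    entanglement (elementaryState d n m) ≤ entanglement (elementaryState d n 1) :=
  entanglement_elementaryState_le_of_zeroCount_le hn fun _ =>
    zeroCount_le_of_gcd_dvd (by simp) _

end QuditHypergraph

theorem mainTheorem6 (d n : ℕ) (hd : 2 ≤ d) (hn : 2 ≤ n) :
    (∀ m' : ℕ, m' ∣ d → m' < d →
      (∃ β ∈ Set.Ico 1 (d / m'), β * m' = d / (d / m').minFac) ∧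
      IsLeast
        ((fun β : ℕ => QuditHypergraph.entanglement
            (QuditHypergraph.elementaryState d n (β * m'))) '' Set.Ico 1 (d / m'))
        (QuditHypergraph.entanglement
          (QuditHypergraph.elementaryState d n (d / (d / m').minFac)))) ∧
    (∀ m : ℕ, 1 ≤ m → m < d →
      QuditHypergraph.entanglement (QuditHypergraph.elementaryState d n (d / d.minFac)) ≤
          QuditHypergraph.entanglement (QuditHypergraph.elementaryState d n m) ∧
        QuditHypergraph.entanglement (QuditHypergraph.elementaryState d n m) ≤
          QuditHypergraph.entanglement (QuditHypergraph.elementaryState d n 1)) := by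
  have : NeZero d := ⟨by lia⟩
  refine ⟨fun m' hm'd hm' => ?_, fun m hm hmd => ⟨?_, ?_⟩⟩
  · have hβ := QuditHypergraph.exists_mul_eq_div_minFac hm'd hm'
    refine ⟨hβ, ?_, ?_⟩
    · obtain ⟨β, hβ, h⟩ := hβ
      exact ⟨β, hβ, by simp only [h]⟩
    · rintro _ ⟨β, ⟨hβ, hβd⟩, rfl⟩
      have hm'0 : 0 < m' := Nat.pos_of_dvd_of_pos hm'd (NeZero.pos d)
      refine QuditHypergraph.entanglement_div_minFac_le hn hm'd (dvd_mul_left m' β) ?_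
      exact Nat.not_dvd_of_pos_of_lt (Nat.mul_pos hβ hm'0)
        ((Nat.lt_div_iff_mul_lt_of_dvd hm'0.ne' hm'd).1 hβd)
  · simpa only [Nat.div_one] using QuditHypergraph.entanglement_div_minFac_le hn (one_dvd d)
      (one_dvd m) (Nat.not_dvd_of_pos_of_lt hm hmd)
  · exact QuditHypergraph.entanglement_le_entanglement_one hn m
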